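/- For a finite simple graph $G$ with vertex set $V$, call a set $K\subseteq V$ convex if it contains every vertex lying on a shortest path between two elements of $K$, and let $[P]$ denote the convex hull of $P\subseteq V$, i.e. the intersection of all convex sets containing $P$. In the achievement game $\mathrm{GEN}(G)$ two players alternately select previously unselected vertices of $G$, starting from $P=\emptyset$, and the game ends as soon as the set $P$ of jointly selected vertices satisfies $[P]=V$; the last player to move wins. The nim-number of a position is defined recursively as the smallest nonnegative integer that is not the nim-number of one of its options (the positions reachable from it in one move), and $\operatorname{nim}(\mathrm{GEN}(G))$ is the nim-number of the starting position $\emptyset$. For $n\ge 5$ let $W_n=K_1+C_{n-1}$ be the wheel graph on $n$ vertices, i.e. the join of a single vertex with a cycle on $n-1$ vertices, and let $\operatorname{pty}(n)\in\{0,1\}$ be the remainder of $n$ modulo $2$. Then $$\operatorname{nim}(\mathrm{GEN}(W_n))=\begin{cases}2, & n=5,\\ \operatorname{pty}(n), & n\ge 6.\end{cases}$$ -/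

import Mathlib

universe u v

/-! ### Impartial games and nim-numbers -/

/-- The minimum excludant of a set of nonnegative integers: the smallest one not in the set. -/
noncomputable def mex (A : Set ℕ) : ℕ := sInf Aᶜ

/-- The parity of a nonnegative integer. -/
def pty (k : ℕ) : ℕ := k % 2

/-- A finite impartial game: a finite digraph (given by its out-neighbor sets `Opt`) with a unique
source `start` and no infinite directed walk. -/
structure ImpartialGame where
  /-- The positions. -/
  Pos : Type u
  finite : Finite Pos
  /-- The set of options (out-neighbors) of a position. -/
  Opt : Pos → Set Pos
  /-- The starting position. -/
  start : Pos
  isSource_iff : ∀ P : Pos, (∀ Q : Pos, P ∉ Opt Q) ↔ P = start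
  wf : WellFounded fun Q P : Pos => Q ∈ Opt P

namespace ImpartialGame

/-- The nim-number of a position: the minimum excludant of the nim-numbers of its options. -/
noncomputable def nimPos (𝒢 : ImpartialGame.{u}) : 𝒢.Pos → ℕ :=
  𝒢.wf.fix fun P ih => mex {k | ∃ (Q : 𝒢.Pos) (hQ : Q ∈ 𝒢.Opt P), ih Q hQ = k}

/-- The defining recursion of the nim-number. -/
theorem nimPos_eq (𝒢 : ImpartialGame.{u}) (P : 𝒢.Pos) :
    𝒢.nimPos P = mex (𝒢.nimPos '' 𝒢.Opt P) := by
  unfold nimPos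
  rw [WellFounded.fix_eq]
  congr 1
  ext k
  simp [Set.mem_image]

/-- The nim-number of a game is the nim-number of its starting position. -/
noncomputable def nim (𝒢 : ImpartialGame.{u}) : ℕ := 𝒢.nimPos 𝒢.start

end ImpartialGame

/-! ### Geodetic convexity -/

/-- A walk is a geodesic if it is a shortest one between its endpoints
(it is then automatically a path). -/
def IsGeodesic {V : Type u} {G : SimpleGraph V} {a b : V} (p : G.Walk a b) : Prop :=
  p.length = G.dist a b

/-- A set of vertices is (geodetically) convex if it contains all the vertices on every geodesic
connecting two of its elements. -/
def IsGeodeticallyConvex {V : Type u} (G : SimpleGraph V) (K : Set V) : Prop :=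
  ∀ a ∈ K, ∀ b ∈ K, ∀ p : G.Walk a b, IsGeodesic p → ∀ w ∈ p.support, w ∈ K

/-- The convex hull of a set of vertices: the intersection of the convex sets containing it. -/
def geodeticHull {V : Type u} (G : SimpleGraph V) (P : Set V) : Set V :=
  ⋂₀ {K | P ⊆ K ∧ IsGeodeticallyConvex G K}

/-- A set of vertices is generating if its convex hull is the whole vertex set. -/
def IsGenerating {V : Type u} (G : SimpleGraph V) (P : Set V) : Prop :=
  geodeticHull G P = Set.univ

theorem IsGenerating.mono {V : Type u} {G : SimpleGraph V} {P Q : Set V} (hPQ : P ⊆ Q)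
    (hP : IsGenerating G P) : IsGenerating G Q := by
  refine Set.eq_univ_of_univ_subset (hP.symm.subset.trans ?_)
  exact Set.sInter_subset_sInter fun K hK => ⟨hPQ.trans hK.1, hK.2⟩

/-! ### The achievement game -/

section GEN

variable {V : Type u} [Fintype V] [DecidableEq V]

/-- The sets of jointly selected vertices that can occur in the achievement game on `G`: the
empty set, and the sets that arise by selecting a vertex when the previously
selected vertices do not yet generate. -/
def IsGENPosition (G : SimpleGraph V) (P : Finset V) : Prop :=
  P = ∅ ∨ ∃ x ∈ P, ¬ IsGenerating G (P.erase x : Finset V)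

/-- The achievement game "generate" on `G`: players alternately select a previously unselected
vertex, starting from the empty set, and the game ends as soon as the set of jointly
selected vertices is generating. -/
abbrev GEN (G : SimpleGraph V) : ImpartialGame.{u} where
  Pos := {P : Finset V // IsGENPosition G P}
  finite := inferInstance
  Opt P := {Q | ¬ IsGenerating G (P.1 : Set V) ∧ ∃ x ∉ P.1, Q.1 = insert x P.1}
  start := ⟨∅, Or.inl rfl⟩
  isSource_iff := by
    rintro ⟨P, hP⟩
    constructor
    · intro h
      rcases hP with rfl | ⟨x, hx, hgen⟩
      · rfl
      · have hpos : IsGENPosition G (P.erase x) := by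
          rcases (P.erase x).eq_empty_or_nonempty with h0 | ⟨y, hy⟩
          · exact Or.inl h0
          · refine Or.inr ⟨y, hy, fun hy' => hgen (hy'.mono ?_)⟩
            exact_mod_cast Finset.erase_subset y (P.erase x)
        exact absurd ⟨hgen, x, Finset.notMem_erase x P, (Finset.insert_erase hx).symm⟩
          (h ⟨P.erase x, hpos⟩)
    · intro h
      obtain rfl : P = ∅ := congrArg Subtype.val h
      rintro Q ⟨-, x, -, hQ⟩
      exact Finset.insert_ne_empty x Q.1 hQ.symm
  wf := by
    refine Subrelation.wf ?_ (measure fun P : {P : Finset V // IsGENPosition G P} =>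
      Fintype.card V - P.1.card).wf
    rintro Q P ⟨-, x, hx, hQ⟩
    have h1 : Q.1.card = P.1.card + 1 := by rw [hQ, Finset.card_insert_of_notMem hx]
    have h2 := Q.1.card_le_univ
    change Fintype.card V - Q.1.card < Fintype.card V - P.1.card
    omega

end GEN

/-! ### Wheel graphs -/

/-- The join of two graphs: their disjoint union together with all edges between them. -/
def graphJoin {V : Type u} {W : Type v} (G : SimpleGraph V) (H : SimpleGraph W) :
    SimpleGraph (V ⊕ W) :=
  SimpleGraph.sum G H ⊔ completeBipartiteGraph V W

/-- The wheel graph `W_n = K_1 + C_{n-1}` on `n` vertices (meant for `n ≥ 5`). -/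
def wheelGraph (n : ℕ) : SimpleGraph (Fin 1 ⊕ Fin (n - 1)) :=
  graphJoin (⊤ : SimpleGraph (Fin 1)) (SimpleGraph.cycleGraph (n - 1))

/-! ### Minimum excludants and nim-numbers -/

/-! A set generates the wheel exactly when it meets every rim edge
(`generatingIffCovers_wheelGraph`), so the game is to build a vertex cover of the rim, a
triangle-free graph. With an even number of vertices unselected, a pairing argument gives nim-number
0 if two disjoint edges are uncovered (`nimPos_GEN_eq_zero`), and 1 if some edge is uncovered but no
two disjoint ones are (`nimPos_GEN_eq_one`).

For even `n` the starting position is of the first kind. For odd `n` all its options have even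
complement: when `n ≥ 7` they are all of the first kind, so the start has value 1; when `n = 5` the
hub gives 0 and a rim vertex gives 1, so the start has value 2. -/

theorem mex_notMem {A : Set ℕ} (hA : A.Finite) : mex A ∉ A :=
  Nat.sInf_mem hA.infinite_compl.nonempty

theorem mex_eq_of_forall_lt {A : Set ℕ} {k : ℕ} (hk : k ∉ A) (h : ∀ j < k, j ∈ A) :
    mex A = k := by
  refine le_antisymm (Nat.sInf_le hk) (le_csInf ⟨k, hk⟩ fun j hj => ?_)
  by_contra hlt
  exact hj (h j (not_le.mp hlt))

namespace ImpartialGame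

/-- Used in reverse: an option does not have value `v` once a reply of value `v` is found.
Finiteness excludes the default value of `sInf ∅` in `mex`. -/
theorem nimPos_ne_of_mem_opt (𝒢 : ImpartialGame.{u}) {P Q : 𝒢.Pos} (hQ : Q ∈ 𝒢.Opt P) :
    𝒢.nimPos P ≠ 𝒢.nimPos Q := by
  have := 𝒢.finite
  intro h
  have hmex := mex_notMem (Set.toFinite (𝒢.nimPos '' 𝒢.Opt P))
  rw [← nimPos_eq, h] at hmex
  exact hmex (Set.mem_image_of_mem _ hQ)

theorem nimPos_eq_of_forall_lt (𝒢 : ImpartialGame.{u}) {P : 𝒢.Pos} {k : ℕ}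
    (hk : ∀ Q ∈ 𝒢.Opt P, 𝒢.nimPos Q ≠ k) (h : ∀ j < k, ∃ Q ∈ 𝒢.Opt P, 𝒢.nimPos Q = j) :
    𝒢.nimPos P = k := by
  rw [nimPos_eq]
  refine mex_eq_of_forall_lt ?_ h
  rintro ⟨Q, hQ, hQk⟩
  exact hk Q hQ hQk

end ImpartialGame

/-! ### Achievement games whose generating sets are the vertex covers of a triangle-free graph -/

/-- The graph `H` has two disjoint edges that avoid the set `P`. -/
def HasDisjointEdgesOff {V : Type u} (H : SimpleGraph V) (P : Finset V) : Prop :=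
  ∃ a b c d, H.Adj a b ∧ H.Adj c d ∧ (a ≠ c ∧ a ≠ d ∧ b ≠ c ∧ b ≠ d) ∧
    a ∉ P ∧ b ∉ P ∧ c ∉ P ∧ d ∉ P

theorem HasDisjointEdgesOff.anti {V : Type u} {H : SimpleGraph V} {P Q : Finset V}
    (hPQ : P ⊆ Q) (hQ : HasDisjointEdgesOff H Q) : HasDisjointEdgesOff H P := by
  obtain ⟨a, b, c, d, hab, hcd, hne, ha, hb, hc, hd⟩ := hQ
  exact ⟨a, b, c, d, hab, hcd, hne, fun h => ha (hPQ h), fun h => hb (hPQ h),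
    fun h => hc (hPQ h), fun h => hd (hPQ h)⟩

section VertexCover

variable {V : Type u} {G H : SimpleGraph V}

/-- The generating sets of `G` are the vertex covers of `H`. -/
def GeneratingIffCovers (G H : SimpleGraph V) : Prop :=
  ∀ P : Finset V, IsGenerating G (P : Set V) ↔ ∀ a b, H.Adj a b → a ∈ P ∨ b ∈ P

theorem HasDisjointEdgesOff.not_isGenerating (hGH : GeneratingIffCovers G H) {P : Finset V}
    (hP : HasDisjointEdgesOff H P) : ¬ IsGenerating G (P : Set V) := by
  obtain ⟨a, b, -, -, hab, -, -, ha, hb, -, -⟩ := hP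
  exact fun h => ((hGH P).mp h a b hab).elim ha hb

variable [DecidableEq V]

/-- Pairwise intersecting edges form a star or a triangle, so here one vertex finishes the cover. If
neither end of an uncovered edge `ab` works, some uncovered edge through `b` avoids `a` and another
through `a` avoids `b`; these must meet, closing a triangle. -/
theorem exists_insert_covers
    (htri : ∀ a b c, H.Adj a b → H.Adj b c → ¬ H.Adj a c) {P : Finset V}
    (hcov : ¬ ∀ a b, H.Adj a b → a ∈ P ∨ b ∈ P) (hP : ¬ HasDisjointEdgesOff H P) :
    ∃ x ∉ P, ∀ a b, H.Adj a b → a ∈ insert x P ∨ b ∈ insert x P := by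
  push Not at hcov
  obtain ⟨a, b, hab, ha, hb⟩ := hcov
  by_contra! hno
  obtain ⟨c, d, hcd, hc, hd⟩ := hno a ha
  obtain ⟨e, f, hef, he, hf⟩ := hno b hb
  simp only [Finset.mem_insert, not_or] at hc hd he hf
  have key : ∀ p q r s, H.Adj p q → H.Adj r s → p ∉ P → q ∉ P → r ∉ P → s ∉ P →
      p = r ∨ p = s ∨ q = r ∨ q = s := by
    intro p q r s h1 h2 hp hq hr hs
    by_contra! hne
    exact hP ⟨p, q, r, s, h1, h2, hne, hp, hq, hr, hs⟩
  have k1 := key a b c d hab hcd ha hb hc.2 hd.2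
  have k2 := key a b e f hab hef ha hb he.2 hf.2
  have k3 := key c d e f hcd hef hc.2 hd.2 he.2 hf.2
  have hbc : c = b ∨ d = b := by grind
  have hae : e = a ∨ f = a := by grind
  rcases hbc with rfl | rfl <;> rcases hae with rfl | rfl
  · obtain rfl : d = f := by grind
    exact htri _ _ _ hab hcd hef
  · obtain rfl : d = e := by grind
    exact htri _ _ _ hab hcd hef.symm
  · obtain rfl : c = f := by grind
    exact htri _ _ _ hab hcd.symm hef
  · obtain rfl : c = e := by grind
    exact htri _ _ _ hab hcd.symm hef.symm

theorem isGENPosition_insert {P : Finset V} {x : V} (hx : x ∉ P)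
    (hgen : ¬ IsGenerating G (P : Set V)) : IsGENPosition G (insert x P) :=
  Or.inr ⟨x, Finset.mem_insert_self x P, by rwa [Finset.erase_insert hx]⟩

variable [Fintype V]

theorem even_card_compl_insert {P : Finset V} {x : V} (hx : x ∉ P) :
    Even (insert x P)ᶜ.card ↔ ¬ Even Pᶜ.card := by
  have h : (insert x P)ᶜ.card + 1 = Pᶜ.card := by
    rw [Finset.compl_insert, Finset.card_erase_add_one (Finset.mem_compl.mpr hx)]
  rw [← h, Nat.even_add_one, not_not]

theorem card_compl_insert_lt {P : Finset V} {x : V} (hx : x ∉ P) :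
    (insert x P)ᶜ.card < Pᶜ.card := by
  rw [Finset.compl_insert]
  exact Finset.card_erase_lt_of_mem (Finset.mem_compl.mpr hx)

/-- Supplies the parity reply: a move sparing the endpoints of edges that should stay uncovered. -/
theorem exists_notMem_of_not_even {P S : Finset V} (hS : S ⊆ Pᶜ) (hSe : Even S.card)
    (hP : ¬ Even Pᶜ.card) : ∃ x ∉ P, x ∉ S := by
  obtain ⟨x, hx, hxS⟩ := Finset.exists_of_ssubset (hS.ssubset_of_ne fun h => hP (h ▸ hSe))
  exact ⟨x, Finset.mem_compl.mp hx, hxS⟩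

theorem nimPos_GEN_eq_zero_of_isGenerating {P : (GEN G).Pos}
    (hP : IsGenerating G (P.1 : Set V)) : (GEN G).nimPos P = 0 :=
  ImpartialGame.nimPos_eq_of_forall_lt _ (fun _ hQ => absurd hP hQ.1)
    fun _ hj => absurd hj (Nat.not_lt_zero _)

theorem HasDisjointEdgesOff.exists_insert {P : Finset V} (hP : HasDisjointEdgesOff H P)
    (hodd : ¬ Even Pᶜ.card) : ∃ x ∉ P, HasDisjointEdgesOff H (insert x P) := by
  obtain ⟨a, b, c, d, hab, hcd, hne, ha, hb, hc, hd⟩ := hP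
  have hcard : ({a, b, c, d} : Finset V).card = 4 := by
    have h1 := hab.ne
    have h2 := hcd.ne
    rw [Finset.card_insert_of_notMem (by grind), Finset.card_insert_of_notMem (by grind),
      Finset.card_pair h2]
  obtain ⟨x, hx, hxS⟩ := exists_notMem_of_not_even (P := P) (S := {a, b, c, d})
    (by intro y; simp only [Finset.mem_insert, Finset.mem_singleton, Finset.mem_compl]; grind)
    (by rw [hcard]; decide) hodd
  simp only [Finset.mem_insert, Finset.mem_singleton, not_or] at hxS
  refine ⟨x, hx, a, b, c, d, hab, hcd, hne, ?_⟩
  simp only [Finset.mem_insert, not_or]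
  grind

/-- An even number of unselected vertices with two disjoint edges among them is a loss for the
player to move. -/
theorem nimPos_GEN_eq_zero (hGH : GeneratingIffCovers G H)
    (htri : ∀ a b c, H.Adj a b → H.Adj b c → ¬ H.Adj a c) (P : (GEN G).Pos)
    (hP : HasDisjointEdgesOff H P.1) (heven : Even P.1ᶜ.card) : (GEN G).nimPos P = 0 := by
  refine ImpartialGame.nimPos_eq_of_forall_lt _ ?_ fun _ hj => absurd hj (Nat.not_lt_zero _)
  rintro ⟨Q, hQpos⟩ ⟨hgen, x, hx, rfl : Q = _⟩
  have hodd : ¬ Even (insert x P.1)ᶜ.card := by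
    rw [even_card_compl_insert hx, not_not]; exact heven
  -- One vertex cannot meet two disjoint edges, so the game goes on.
  have hQgen : ¬ IsGenerating G ((insert x P.1 : Finset V) : Set V) := by
    rw [hGH]
    obtain ⟨a, b, c, d, hab, hcd, hne, ha, hb, hc, hd⟩ := hP
    intro h
    have h1 := h a b hab
    have h2 := h c d hcd
    simp only [Finset.mem_insert] at h1 h2
    grind
  -- The reply either restores the hypotheses, by parity, or finishes the game; its value is 0 both
  -- times.
  by_cases hQ : HasDisjointEdgesOff H (insert x P.1)
  · obtain ⟨y, hy, hR⟩ := hQ.exists_insert hodd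
    have hRpos := isGENPosition_insert (G := G) hy hQgen
    rw [← nimPos_GEN_eq_zero hGH htri ⟨_, hRpos⟩ hR
      ((even_card_compl_insert hy).mpr hodd)]
    exact ImpartialGame.nimPos_ne_of_mem_opt _ ⟨hQgen, y, hy, rfl⟩
  · obtain ⟨y, hy, hR⟩ := exists_insert_covers htri (mt (hGH _).mpr hQgen) hQ
    have hRpos := isGENPosition_insert (G := G) hy hQgen
    rw [← nimPos_GEN_eq_zero_of_isGenerating (P := ⟨_, hRpos⟩) ((hGH _).mpr hR)]
    exact ImpartialGame.nimPos_ne_of_mem_opt _ ⟨hQgen, y, hy, rfl⟩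
termination_by P.1ᶜ.card
decreasing_by exact (card_compl_insert_lt hy).trans (card_compl_insert_lt hx)

/-- An even number of unselected vertices with an edge but no two disjoint edges among them
has nim-number one. -/
theorem nimPos_GEN_eq_one (hGH : GeneratingIffCovers G H)
    (htri : ∀ a b c, H.Adj a b → H.Adj b c → ¬ H.Adj a c) (P : (GEN G).Pos)
    (hPgen : ¬ IsGenerating G (P.1 : Set V)) (hP : ¬ HasDisjointEdgesOff H P.1)
    (heven : Even P.1ᶜ.card) : (GEN G).nimPos P = 1 := by
  refine ImpartialGame.nimPos_eq_of_forall_lt _ ?_ ?_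
  · rintro ⟨Q, hQpos⟩ ⟨hgen, x, hx, rfl : Q = _⟩
    have hodd : ¬ Even (insert x P.1)ᶜ.card := by
      rw [even_card_compl_insert hx, not_not]; exact heven
    by_cases hQgen : IsGenerating G ((insert x P.1 : Finset V) : Set V)
    · rw [nimPos_GEN_eq_zero_of_isGenerating hQgen]
      exact zero_ne_one
    · obtain ⟨a, b, hab, ha, hb⟩ : ∃ a b, H.Adj a b ∧ a ∉ insert x P.1 ∧ b ∉ insert x P.1 := by
        have := mt (hGH _).mpr hQgen
        push Not at this
        exact this
      -- Sparing `a` and `b` keeps the edge uncovered, so the reply returns to a position of value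
      -- 1.
      obtain ⟨y, hy, hyS⟩ := exists_notMem_of_not_even (P := insert x P.1) (S := {a, b})
        (by intro z hz; rw [Finset.mem_insert, Finset.mem_singleton] at hz
            rcases hz with rfl | rfl <;> rwa [Finset.mem_compl])
        (by rw [Finset.card_pair hab.ne]; decide) hodd
      simp only [Finset.mem_insert, Finset.mem_singleton, not_or] at hyS
      have hRgen : ¬ IsGenerating G ((insert y (insert x P.1) : Finset V) : Set V) := by
        rw [hGH]
        intro h
        have h1 := h a b hab
        rw [Finset.mem_insert, Finset.mem_insert (s := insert x P.1)] at h1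
        grind
      have hRpos := isGENPosition_insert (G := G) hy hQgen
      rw [← nimPos_GEN_eq_one hGH htri ⟨_, hRpos⟩ hRgen
        (fun h => hP (h.anti ((Finset.subset_insert _ _).trans (Finset.subset_insert _ _))))
        ((even_card_compl_insert hy).mpr hodd)]
      exact ImpartialGame.nimPos_ne_of_mem_opt _ ⟨hQgen, y, hy, rfl⟩
  · intro j hj
    obtain rfl : j = 0 := by omega
    obtain ⟨y, hy, hR⟩ := exists_insert_covers htri (mt (hGH _).mpr hPgen) hP
    exact ⟨⟨_, isGENPosition_insert hy hPgen⟩, ⟨hPgen, y, hy, rfl⟩,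
      nimPos_GEN_eq_zero_of_isGenerating ((hGH _).mpr hR)⟩
termination_by P.1ᶜ.card
decreasing_by exact (card_compl_insert_lt hy).trans (card_compl_insert_lt hx)

end VertexCover

/-! ### Geodetic convexity in graphs of diameter two -/

theorem IsGeodeticallyConvex.mem_of_adj {V : Type u} {G : SimpleGraph V} {K : Set V}
    (hK : IsGeodeticallyConvex G K) {a b w : V} (ha : a ∈ K) (hb : b ∈ K) (hab : a ≠ b)
    (hnadj : ¬ G.Adj a b) (haw : G.Adj a w) (hwb : G.Adj w b) : w ∈ K := by
  refine hK a ha b hb (.cons haw (.cons hwb .nil)) ?_ w (by simp)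
  have h1 : G.dist a b ≤ 2 := SimpleGraph.dist_le (.cons haw (.cons hwb .nil))
  -- Reachability is needed, since `dist` is also 0 between different components.
  have h2 : G.dist a b ≠ 0 := fun h =>
    hab ((haw.reachable.trans hwb.reachable).dist_eq_zero_iff.mp h)
  have h3 : G.dist a b ≠ 1 := fun h => hnadj (SimpleGraph.dist_eq_one_iff_adj.mp h)
  simp only [IsGeodesic, SimpleGraph.Walk.length_cons, SimpleGraph.Walk.length_nil]
  omega

theorem isGeodeticallyConvex_of_dist_le_two {V : Type u} {G : SimpleGraph V} {K : Set V}
    (hdist : ∀ a b, G.dist a b ≤ 2)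
    (h : ∀ a ∈ K, ∀ b ∈ K, ∀ w, a ≠ b → ¬ G.Adj a b → G.Adj a w → G.Adj w b → w ∈ K) :
    IsGeodeticallyConvex G K := by
  intro a ha b hb p hp w hw
  unfold IsGeodesic at hp
  match p with
  | .nil =>
    rw [SimpleGraph.Walk.support_nil, List.mem_singleton] at hw
    exact hw ▸ ha
  | .cons _ .nil =>
    simp only [SimpleGraph.Walk.support_cons, SimpleGraph.Walk.support_nil, List.mem_cons,
      List.not_mem_nil, or_false] at hw
    rcases hw with rfl | rfl <;> assumption
  | .cons haw (.cons hwb .nil) =>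
    simp only [SimpleGraph.Walk.support_cons, SimpleGraph.Walk.support_nil, List.mem_cons,
      List.not_mem_nil, or_false] at hw
    simp only [SimpleGraph.Walk.length_cons, SimpleGraph.Walk.length_nil] at hp
    rcases hw with rfl | rfl | rfl
    · exact ha
    · refine h a ha b hb _ ?_ ?_ haw hwb
      · rintro rfl
        simp at hp
      · intro hadj
        rw [SimpleGraph.dist_eq_one_iff_adj.mpr hadj] at hp
        omega
    · exact hb
  | .cons _ (.cons _ (.cons _ q)) =>
    have := hdist a b
    simp only [SimpleGraph.Walk.length_cons] at hp
    omega

/-! ### Wheels -/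

section Wheel

variable {k : ℕ}

/-- The rim of the wheel, as a graph on all the vertices of the wheel. -/
def rimGraph (m : ℕ) : SimpleGraph (Fin 1 ⊕ Fin m) :=
  SimpleGraph.sum ⊥ (SimpleGraph.cycleGraph m)

theorem cycleGraph_adj_iff_add_one {i j : Fin (k + 4)} :
    (SimpleGraph.cycleGraph (k + 4)).Adj i j ↔ j = i + 1 ∨ i = j + 1 := by
  rw [SimpleGraph.cycleGraph_adj, sub_eq_iff_eq_add', sub_eq_iff_eq_add', or_comm]

theorem rimGraph_adj_iff {a b : Fin 1 ⊕ Fin (k + 4)} :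
    (rimGraph (k + 4)).Adj a b ↔
      ∃ i, (a = .inr i ∧ b = .inr (i + 1)) ∨ (b = .inr i ∧ a = .inr (i + 1)) := by
  rcases a with a | a <;> rcases b with b | b <;>
    simp [rimGraph, cycleGraph_adj_iff_add_one, exists_or]

theorem wheelGraph_adj_inr {i j : Fin (k + 4)} :
    (wheelGraph (k + 5)).Adj (.inr i) (.inr j) ↔ j = i + 1 ∨ i = j + 1 := by
  simp [wheelGraph, graphJoin, cycleGraph_adj_iff_add_one]

theorem wheelGraph_adj_hub (h : Fin 1) (i : Fin (k + 4)) :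
    (wheelGraph (k + 5)).Adj (.inl h) (.inr i) := by
  simp [wheelGraph, graphJoin]

theorem dist_wheelGraph_le_two (a b : Fin 1 ⊕ Fin (k + 4)) :
    (wheelGraph (k + 5)).dist a b ≤ 2 := by
  rcases a with a | a <;> rcases b with b | b
  · rw [Subsingleton.elim a b, SimpleGraph.dist_self]
    exact Nat.zero_le _
  · exact (SimpleGraph.dist_eq_one_iff_adj.mpr (wheelGraph_adj_hub a b)).trans_le one_le_two
  · exact (SimpleGraph.dist_eq_one_iff_adj.mpr (wheelGraph_adj_hub b a).symm).trans_le one_le_two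
  · exact SimpleGraph.dist_le (.cons (wheelGraph_adj_hub 0 a).symm
      (.cons (wheelGraph_adj_hub 0 b) .nil))

theorem Fin.ne_add_one (i : Fin (k + 4)) : i ≠ i + 1 := by
  simp

theorem Fin.ne_add_two (i : Fin (k + 4)) : i ≠ i + 1 + 1 := by
  intro h
  simp only [add_assoc, left_eq_add] at h
  have := congrArg Fin.val h
  simp only [Fin.val_add, Fin.val_one, Fin.val_zero] at this
  rw [Nat.mod_eq_of_lt (by omega)] at this
  omega

theorem Fin.ne_add_three (i : Fin (k + 4)) : i ≠ i + 1 + 1 + 1 := by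
  intro h
  simp only [add_assoc, left_eq_add] at h
  have := congrArg Fin.val h
  simp only [Fin.val_add, Fin.val_one, Nat.add_mod_mod, Fin.val_zero] at this
  rw [Nat.mod_eq_of_lt (by omega)] at this
  omega

/-- This fails in `Fin 4`, which is what sets `n = 5` apart. -/
theorem Fin.ne_add_four (i : Fin (k + 5)) : i ≠ i + 1 + 1 + 1 + 1 := by
  intro h
  simp only [add_assoc, left_eq_add] at h
  have := congrArg Fin.val h
  simp only [Fin.val_add, Fin.val_one, Nat.add_mod_mod, Fin.val_zero] at this
  rw [Nat.mod_eq_of_lt (by omega)] at this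
  omega

theorem inr_ne_inr_add_two (i : Fin (k + 4)) :
    (Sum.inr i : Fin 1 ⊕ Fin (k + 4)) ≠ .inr (i + 1 + 1) :=
  fun h => Fin.ne_add_two i (Sum.inr.inj h)

theorem not_adj_wheelGraph_add_two (i : Fin (k + 4)) :
    ¬ (wheelGraph (k + 5)).Adj (.inr i) (.inr (i + 1 + 1 : Fin (k + 4))) := by
  rw [wheelGraph_adj_inr]
  exact not_or.mpr ⟨(Fin.ne_add_one (i + 1)).symm, Fin.ne_add_three i⟩

/-- An end of the removed edge has only one rim neighbor left, and the hub is adjacent to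
everything, so no nonadjacent pair in the complement has that end as a common neighbor. -/
theorem isGeodeticallyConvex_compl_rim_edge (i : Fin (k + 4)) :
    IsGeodeticallyConvex (wheelGraph (k + 5))
      ({.inr i, .inr (i + 1)}ᶜ : Set (Fin 1 ⊕ Fin (k + 4))) := by
  refine isGeodeticallyConvex_of_dist_le_two dist_wheelGraph_le_two ?_
  intro a ha b hb w hab hnadj haw hwb hw
  have hbw := hwb.symm
  rcases a with a | a <;> rcases b with b | b
  · exact hab (congrArg _ (Subsingleton.elim a b))
  · exact hnadj (wheelGraph_adj_hub a b)
  · exact hnadj (wheelGraph_adj_hub b a).symm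
  · simp only [Set.mem_compl_iff, Set.mem_insert_iff, Set.mem_singleton_iff, Sum.inr.injEq,
      not_or] at ha hb
    have hab' : a ≠ b := fun h => hab (congrArg _ h)
    rcases hw with rfl | rfl <;> rw [wheelGraph_adj_inr] at haw hbw <;> grind

theorem generatingIffCovers_wheelGraph :
    GeneratingIffCovers (wheelGraph (k + 5)) (rimGraph (k + 4)) := by
  intro (P : Finset (Fin 1 ⊕ Fin (k + 4)))
  change IsGenerating (wheelGraph (k + 5)) (P : Set (Fin 1 ⊕ Fin (k + 4))) ↔
    ∀ a b : Fin 1 ⊕ Fin (k + 4), (rimGraph (k + 4)).Adj a b → a ∈ P ∨ b ∈ P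
  constructor
  · have key : IsGenerating (wheelGraph (k + 5)) (P : Set (Fin 1 ⊕ Fin (k + 4))) →
        ∀ i : Fin (k + 4), .inr i ∈ P ∨ .inr (i + 1) ∈ P := by
      intro hgen i
      by_contra! hi
      have hmem : (Sum.inr i : Fin 1 ⊕ Fin (k + 4)) ∈
          geodeticHull (wheelGraph (k + 5)) (P : Set (Fin 1 ⊕ Fin (k + 4))) :=
        hgen.symm ▸ Set.mem_univ _
      refine hmem _ ⟨?_, isGeodeticallyConvex_compl_rim_edge i⟩ (Set.mem_insert _ _)
      rintro x hx (rfl | rfl)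
      · exact hi.1 hx
      · exact hi.2 hx
    intro hgen a b hab
    obtain ⟨i, ⟨rfl, rfl⟩ | ⟨rfl, rfl⟩⟩ := rimGraph_adj_iff.mp hab
    · exact key hgen i
    · exact (key hgen i).symm
  · intro hcov
    have hcov' : ∀ i : Fin (k + 4), .inr i ∈ P ∨ .inr (i + 1) ∈ P := fun i =>
      hcov _ _ (rimGraph_adj_iff.mpr ⟨i, Or.inl ⟨rfl, rfl⟩⟩)
    refine Set.eq_univ_of_forall fun (w : Fin 1 ⊕ Fin (k + 4)) K ⟨hPK, hK⟩ => ?_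
    -- An unselected rim vertex has both rim neighbors selected, and these are at distance two. The
    -- hub then lies between two nonadjacent rim vertices.
    have hrim : ∀ i : Fin (k + 4), (Sum.inr (i + 1) : Fin 1 ⊕ Fin (k + 4)) ∈ K := by
      intro i
      by_cases hi : .inr (i + 1) ∈ P
      · exact hPK hi
      · refine hK.mem_of_adj (hPK ((hcov' i).resolve_right hi))
          (hPK ((hcov' (i + 1)).resolve_left hi)) (inr_ne_inr_add_two i)
          (not_adj_wheelGraph_add_two i) ?_ ?_ <;>
        exact wheelGraph_adj_inr.mpr (Or.inl rfl)
    rcases w with w | w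
    · exact hK.mem_of_adj (hrim 0) (hrim (0 + 1 + 1)) (inr_ne_inr_add_two _)
        (not_adj_wheelGraph_add_two _)
        (wheelGraph_adj_hub w _).symm (wheelGraph_adj_hub w _)
    · exact sub_add_cancel w 1 ▸ hrim (w - 1)

theorem not_adj_rimGraph_of_adj_adj (a b c : Fin 1 ⊕ Fin (k + 4))
    (hab : (rimGraph (k + 4)).Adj a b) (hbc : (rimGraph (k + 4)).Adj b c) :
    ¬ (rimGraph (k + 4)).Adj a c := by
  rcases a with a | a <;> rcases b with b | b <;> rcases c with c | c <;>
    simp [rimGraph, cycleGraph_adj_iff_add_one] at hab hbc ⊢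
  have h1 := Fin.ne_add_one (k := k)
  have h3 := Fin.ne_add_three (k := k)
  grind

theorem hasDisjointEdgesOff_rimGraph {P : Finset (Fin 1 ⊕ Fin (k + 4))} {i j : Fin (k + 4)}
    (hi : .inr i ∉ P) (hi' : .inr (i + 1) ∉ P) (hj : .inr j ∉ P) (hj' : .inr (j + 1) ∉ P)
    (hij : i ≠ j) (hij' : i ≠ j + 1) (hji : i + 1 ≠ j) :
    HasDisjointEdgesOff (rimGraph (k + 4)) P :=
  ⟨.inr i, .inr (i + 1), .inr j, .inr (j + 1), rimGraph_adj_iff.mpr ⟨i, Or.inl ⟨rfl, rfl⟩⟩,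
    rimGraph_adj_iff.mpr ⟨j, Or.inl ⟨rfl, rfl⟩⟩,
    by simpa using ⟨hij, hij', hji, hij⟩, hi, hi', hj, hj'⟩

theorem hasDisjointEdgesOff_rimGraph_of_forall {P : Finset (Fin 1 ⊕ Fin (k + 4))}
    (hP : ∀ i, .inr i ∉ P) : HasDisjointEdgesOff (rimGraph (k + 4)) P := by
  obtain ⟨i⟩ : Nonempty (Fin (k + 4)) := ⟨0⟩
  exact hasDisjointEdgesOff_rimGraph (hP _) (hP _) (hP _) (hP _) (Fin.ne_add_two i)
    (Fin.ne_add_three i) (Fin.ne_add_one (i + 1))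

/-- Deleting a vertex from a cycle of length at least 5 leaves a path containing the four distinct
vertices `x + 1`, …, `x + 4`. -/
theorem hasDisjointEdgesOff_rimGraph_singleton (x : Fin 1 ⊕ Fin (k + 5)) :
    HasDisjointEdgesOff (rimGraph (k + 5)) {x} := by
  rcases x with x | x
  · exact hasDisjointEdgesOff_rimGraph_of_forall (k := k + 1) (by simp)
  · have hx : ∀ y, y ≠ x → (Sum.inr y : Fin 1 ⊕ Fin (k + 5)) ∉ ({.inr x} : Finset _) := by
      simp
    exact hasDisjointEdgesOff_rimGraph (k := k + 1) (hx _ (Fin.ne_add_one x).symm)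
      (hx _ (Fin.ne_add_two x).symm) (hx _ (Fin.ne_add_three x).symm)
      (hx _ (Fin.ne_add_four x).symm) (Fin.ne_add_two (x + 1)) (Fin.ne_add_three (x + 1))
      (Fin.ne_add_one (x + 1 + 1))

/-- Only three rim vertices remain, too few for two disjoint edges. -/
theorem not_hasDisjointEdgesOff_rimGraph_four (j : Fin 4) :
    ¬ HasDisjointEdgesOff (rimGraph 4) {.inr j} := by
  rintro ⟨a, b, c, d, hab, hcd, hne, ha, hb, hc, hd⟩
  rcases a with a | a <;> rcases b with b | b <;> simp [rimGraph] at hab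
  rcases c with c | c <;> rcases d with d | d <;> simp [rimGraph] at hcd
  have hab := hab.ne
  have hcd := hcd.ne
  simp only [Finset.mem_singleton, Sum.inr.injEq, ne_eq] at *
  omega

theorem card_compl_wheel (P : Finset (Fin 1 ⊕ Fin (k + 4))) : Pᶜ.card = k + 5 - P.card := by
  rw [Finset.card_compl, Fintype.card_sum, Fintype.card_fin, Fintype.card_fin]
  omega

theorem nim_GEN_wheelGraph_of_odd (hk : Odd k) : (GEN (wheelGraph (k + 5))).nim = 0 := by
  refine nimPos_GEN_eq_zero generatingIffCovers_wheelGraph not_adj_rimGraph_of_adj_adj _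
    (hasDisjointEdgesOff_rimGraph_of_forall fun _ => Finset.notMem_empty _) ?_
  rw [card_compl_wheel]
  simp only [Finset.card_empty]
  grind

theorem not_isGenerating_empty_wheelGraph : ¬ IsGenerating (wheelGraph (k + 5))
    ((∅ : Finset (Fin 1 ⊕ Fin (k + 4))) : Set (Fin 1 ⊕ Fin (k + 4))) :=
  (hasDisjointEdgesOff_rimGraph_of_forall fun _ => Finset.notMem_empty _).not_isGenerating
    generatingIffCovers_wheelGraph

theorem nim_GEN_wheelGraph_of_even (hk : Even k) : (GEN (wheelGraph (k + 6 + 1))).nim = 1 := by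
  have hopt : ∀ Q ∈ (GEN (wheelGraph (k + 6 + 1))).Opt (GEN (wheelGraph (k + 6 + 1))).start,
      (GEN (wheelGraph (k + 6 + 1))).nimPos Q = 0 := by
    rintro ⟨Q, hQpos⟩ ⟨-, x, -, rfl : Q = _⟩
    refine nimPos_GEN_eq_zero (generatingIffCovers_wheelGraph (k := k + 2))
      not_adj_rimGraph_of_adj_adj _ (hasDisjointEdgesOff_rimGraph_singleton (k := k + 1) x) ?_
    rw [card_compl_wheel (k := k + 2)]
    simp only [insert_empty_eq, Finset.card_singleton]
    grind
  refine ImpartialGame.nimPos_eq_of_forall_lt _ (fun Q hQ => by rw [hopt Q hQ]; exact zero_ne_one)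
    fun j hj => ?_
  obtain rfl : j = 0 := by omega
  have hgen := not_isGenerating_empty_wheelGraph (k := k + 2)
  have hmem : (⟨_, isGENPosition_insert (Finset.notMem_empty (.inl 0)) hgen⟩ :
      (GEN (wheelGraph (k + 6 + 1))).Pos) ∈ (GEN (wheelGraph (k + 6 + 1))).Opt
        (GEN (wheelGraph (k + 6 + 1))).start :=
    ⟨hgen, .inl 0, Finset.notMem_empty _, rfl⟩
  exact ⟨_, hmem, hopt _ hmem⟩

theorem nim_GEN_wheelGraph_five : (GEN (wheelGraph 5)).nim = 2 := by
  have hgen := not_isGenerating_empty_wheelGraph (k := 0)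
  have hhub : ∀ (x : Fin 1) (h : IsGENPosition (wheelGraph 5) (insert (.inl x) ∅)),
      (GEN (wheelGraph 5)).nimPos ⟨insert (.inl x) ∅, h⟩ = 0 := by
    intro x h
    refine nimPos_GEN_eq_zero (generatingIffCovers_wheelGraph (k := 0))
      not_adj_rimGraph_of_adj_adj _ (hasDisjointEdgesOff_rimGraph_of_forall (by simp)) ?_
    rw [card_compl_wheel (k := 0)]
    simp only [insert_empty_eq, Finset.card_singleton]
    decide
  have hrim : ∀ (x : Fin 4) (h : IsGENPosition (wheelGraph 5) (insert (.inr x) ∅)),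
      (GEN (wheelGraph 5)).nimPos ⟨insert (.inr x) ∅, h⟩ = 1 := by
    intro x h
    refine nimPos_GEN_eq_one (generatingIffCovers_wheelGraph (k := 0))
      not_adj_rimGraph_of_adj_adj _ ?_ (not_hasDisjointEdgesOff_rimGraph_four x) ?_
    · rw [generatingIffCovers_wheelGraph (k := 0)]
      intro hcov
      have := hcov (.inr (x + 1)) (.inr (x + 1 + 1))
        (rimGraph_adj_iff.mpr ⟨_, Or.inl ⟨rfl, rfl⟩⟩)
      simp only [insert_empty_eq, Finset.mem_singleton, Sum.inr.injEq] at this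
      exact (by decide : ∀ y : Fin 4, ¬ (y + 1 = y ∨ y + 1 + 1 = y)) x this
    · rw [card_compl_wheel (k := 0)]
      simp only [insert_empty_eq, Finset.card_singleton]
      decide
  refine ImpartialGame.nimPos_eq_of_forall_lt _ ?_ ?_
  · rintro ⟨Q, hQpos⟩ ⟨-, x | x, -, rfl : Q = _⟩
    · exact (hhub x hQpos).trans_ne (by decide)
    · exact (hrim x hQpos).trans_ne (by decide)
  · intro j hj
    obtain rfl | rfl : j = 0 ∨ j = 1 := by omega
    · exact ⟨⟨_, isGENPosition_insert (Finset.notMem_empty (.inl 0)) hgen⟩,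
        ⟨hgen, .inl 0, Finset.notMem_empty _, rfl⟩, hhub 0 _⟩
    · exact ⟨⟨_, isGENPosition_insert (Finset.notMem_empty (.inr 0)) hgen⟩,
        ⟨hgen, .inr 0, Finset.notMem_empty _, rfl⟩, hrim 0 _⟩

end Wheel

theorem mainTheorem1 :
    (GEN (wheelGraph 5)).nim = 2 ∧
      ∀ n : ℕ, 6 ≤ n → (GEN (wheelGraph n)).nim = pty n := by
  refine ⟨nim_GEN_wheelGraph_five, fun n hn => ?_⟩
  rcases Nat.even_or_odd n with hpar | hpar
  · obtain ⟨k, rfl⟩ : ∃ k, n = k + 5 := ⟨n - 5, by omega⟩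
    rw [nim_GEN_wheelGraph_of_odd (by grind), pty, Nat.even_iff.mp hpar]
  · obtain ⟨k, rfl⟩ : ∃ k, n = k + 6 + 1 := ⟨n - 7, by grind⟩
    rw [nim_GEN_wheelGraph_of_even (by grind), pty, Nat.odd_iff.mp hpar]
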